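/- **Setup.** Fix integers $M\ge 1$, $T\ge 0$, $B\ge 1$ and $W\ge M(T+1)$. A source stream $s[0],s[1],\dots$ with $s[i]\in\mathbb{F}_q^k$ is encoded causally: at the start of macro-packet $i$ the encoder observes $s[i]$ and sends $M$ channel symbols $x[i,j]=f_{i,j}(s[0],\dots,s[i])\in\mathbb{F}_q^n$, $1\le j\le M$, with $n\ge 1$. The channel $\mathcal{C}(N,B,W)$ may erase channel symbols (the erasures are visible to the decoder) so that in every window of $W$ consecutive channel symbols the erasures either form a single burst of at most $B$ consecutive symbols or number at most $N$, in arbitrary positions. A code with rate $R=\frac{k}{Mn}$ over some finite field $\mathbb{F}_q$ achieves $R$ with a delay of $T$ macro-packets if, for every such erasure pattern and every source stream, each $s[i]$ is determined by a decoding function $g_i$ of the received macro-packets $0,\dots,i+T$. The capacity $C$ is the largest achievable rate. **Theorem 3.** For the channel $\mathcal{C}(N=1,B,W)$ with $W\ge M(T+1)$, write $B=bM+B'$ with integers $b\ge 0$ and $0\le B'\le M-1$. Then the largest achievable rate exists and is $$C=\begin{cases} \dfrac{T}{T+b}, & B'\le \dfrac{b}{T+b}M,\ T\ge b,\ T>0,\\[2mm]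 \dfrac{M(T+b+1)-B}{M(T+b+1)}, & B'>\dfrac{b}{T+b}M,\ T>b,\\[2mm] \dfrac{M-B'}{M}, & B'>\dfrac{M}{2},\ T=b,\\[2mm] 0, & T<b. \end{cases}$$ -/

import Mathlib

/-- The sliding-window erasure channel `C(N, B, W)`. Channel uses are numbered `0, 1, 2, …` and
`E` is the set of erased ones. Within every window of `W` consecutive channel uses the erasures
either form a single burst (a block of consecutive channel uses) of length at most `B`, or are at
most `N` in number, in arbitrary positions. -/
def IsErasurePattern (N B W : ℕ) (E : Set ℕ) : Prop :=
  ∀ t : ℕ,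
    (∃ a l : ℕ, l ≤ B ∧ E ∩ Set.Ico t (t + W) = Set.Ico a (a + l)) ∨
      (E ∩ Set.Ico t (t + W)).ncard ≤ N

/-- A streaming code over `F` with `M` channel uses per source symbol and a decoding delay of `T`
macro-packets: source symbols lie in `F ^ k`, channel symbols in `F ^ n`. The `M` channel symbols
of macro-packet `i` are functions of the source symbols `0, …, i`, and the estimate of source
symbol `i` is a function of the received macro-packets `0, …, i + T`, where `none` marks an
erased channel symbol. -/
structure StreamingCode (F : Type) (M T n k : ℕ) where
  /-- the causal encoding functions -/
  enc : (i : ℕ) → Fin M → (Fin (i + 1) → Fin k → F) → Fin n → F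
  /-- the decoding functions -/
  dec : (i : ℕ) → (Fin (i + T + 1) → Fin M → Option (Fin n → F)) → Fin k → F

namespace StreamingCode

/-- The `j`-th channel symbol of macro-packet `i`, for the source stream `s`. -/
def send {F : Type} {M T n k : ℕ} (c : StreamingCode F M T n k) (s : ℕ → Fin k → F)
    (i : ℕ) (j : Fin M) : Fin n → F :=
  c.enc i j (fun l => s l)

open Classical in
/-- The `j`-th channel output of macro-packet `i`, which is channel use number `M * i + j`,
for the source stream `s` and the erasure pattern `E`. -/
noncomputable def receive {F : Type} {M T n k : ℕ} (c : StreamingCode F M T n k) (E : Set ℕ)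
    (s : ℕ → Fin k → F) (i : ℕ) (j : Fin M) : Option (Fin n → F) :=
  if M * i + (j : ℕ) ∈ E then none else some (c.send s i j)

/-- The code is feasible for the channel `C(N, B, W)`: for every admissible erasure pattern and
every source stream, each source symbol is decoded correctly with a delay of `T` macro-packets. -/
def IsFeasible {F : Type} {M T n k : ℕ} (c : StreamingCode F M T n k) (N B W : ℕ) : Prop :=
  ∀ E : Set ℕ, IsErasurePattern N B W E → ∀ (s : ℕ → Fin k → F) (i : ℕ),
    c.dec i (fun l j => c.receive E s l j) = s i

end StreamingCode

/-- The rate `R` is achievable with a delay of `T` macro-packets over `C(N, B, W)`: over some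
finite field there is a feasible streaming code with `k / (M n) = R`. -/
def IsAchievableRate (M T N B W : ℕ) (R : ℝ) : Prop :=
  ∃ (F : Type) (_ : Field F) (_ : Finite F) (n k : ℕ) (c : StreamingCode F M T n k),
    0 < n ∧ c.IsFeasible N B W ∧ R = (k : ℝ) / ((M : ℝ) * (n : ℝ))

/-- `C` is the streaming capacity: the largest achievable rate. -/
def IsStreamingCapacity (M T N B W : ℕ) (C : ℝ) : Prop :=
  IsGreatest {R : ℝ | IsAchievableRate M T N B W R} C

/-! ### Bursts and the converse -/

/-! With `N = 1` an isolated erasure is a burst of length one, so every decoding window shows at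
most one burst, of length at most `B`.

Converse: erase periodically, with gaps so long that each decoding window meets only one burst. Each
symbol is then decodable in turn, earlier packets being rebuilt from earlier symbols, and counting
unerased uses bounds the rate (`mul_period_le`). For `T ≤ b` a single burst at the start can suffice
(`le_of_burst`).

Achievability: the first `u` coordinates of a symbol are repeated `T` frames later, and Cauchy
combinations of the other coordinates are added onto the same parities. Parities after the burst
whose repeated coordinate is known give at least as many Cauchy equations as there are erased
coordinates of the second kind. Once these are solved, the remaining parities reveal the erased
repeated coordinates just in time (`eq_zero_of_layeredOutput_eq_zero`). The parameters chosen for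
each positive capacity value meet the counting condition with equality. -/

theorem isErasurePattern_Ico {N B W : ℕ} (a : ℕ) {l : ℕ} (hl : l ≤ B) :
    IsErasurePattern N B W (Set.Ico a (a + l)) := by
  intro t
  left
  rw [Set.Ico_inter_Ico]
  refine ⟨max a t, min (a + l) (t + W) - max a t, ?_, ?_⟩
  · omega
  · ext x
    simp only [Set.mem_Ico]
    omega

namespace IsErasurePattern

theorem exists_Ico {B W : ℕ} {E : Set ℕ} (hB : 1 ≤ B) (hE : IsErasurePattern 1 B W E) (t : ℕ) :
    ∃ a l : ℕ, l ≤ B ∧ E ∩ Set.Ico t (t + W) = Set.Ico a (a + l) := by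
  rcases hE t with h | h
  · exact h
  · have hfin : (E ∩ Set.Ico t (t + W)).Finite := (Set.finite_Ico _ _).inter_of_right _
    rcases Nat.le_one_iff_eq_zero_or_eq_one.mp h with h | h
    · exact ⟨0, 0, Nat.zero_le _, by simpa using (Set.ncard_eq_zero hfin).mp h⟩
    · obtain ⟨x, hx⟩ := Set.ncard_eq_one.mp h
      refine ⟨x, 1, hB, hx.trans ?_⟩
      ext y
      simp only [Set.mem_singleton_iff, Set.mem_Ico]
      omega

end IsErasurePattern

namespace StreamingCode

variable {F : Type} {M T n k : ℕ}

theorem send_congr (c : StreamingCode F M T n k) {s s' : ℕ → Fin k → F} {i : ℕ}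
    (h : ∀ l ≤ i, s l = s' l) (j : Fin M) : c.send s i j = c.send s' i j := by
  unfold send
  congr 1
  funext l
  exact h _ (Nat.lt_succ_iff.mp l.2)

/-- If the erasures of `E` within the decoding window of each of the first `L` source symbols lie
in a single burst, then the unerased channel uses determine these source symbols. -/
theorem IsFeasible.mul_le_card [Field F] [Finite F] {c : StreamingCode F M T n k} {N B W : ℕ}
    (hc : c.IsFeasible N B W) (E : Set ℕ) [DecidablePred (· ∈ E)] (L : ℕ)
    (hE : ∀ i < L, ∃ a, E ∩ Set.Ico (M * i) (M * (i + T + 1)) ⊆ Set.Ico a (a + B)) :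
    k * L ≤ n * ((Finset.range (M * (L + T))).filter (· ∉ E)).card := by
  classical
  have := Fintype.ofFinite F
  set S := (Finset.range (M * (L + T))).filter (· ∉ E) with hS
  let ext : (Fin L → Fin k → F) → ℕ → Fin k → F :=
    fun σ l => if h : l < L then σ ⟨l, h⟩ else 0
  let Φ : (Fin L → Fin k → F) → (S → Fin n → F) := fun σ x =>
    if h : 0 < M then c.send (ext σ) (x.1 / M) ⟨x.1 % M, Nat.mod_lt _ h⟩ else 0
  have hΦ : Function.Injective Φ := by
    intro σ σ' hσ
    have key : ∀ i < L, ext σ i = ext σ' i := by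
      intro i
      induction i using Nat.strong_induction_on with
      | _ i ih =>
        intro hi
        obtain ⟨a, ha⟩ := hE i hi
        -- `E` itself need not be admissible; the decoder of symbol `i` is fed this single burst
        -- instead.
        have hpat : IsErasurePattern N B W (Set.Ico a (a + B)) := isErasurePattern_Ico a le_rfl
        rw [← hc _ hpat (ext σ) i, ← hc _ hpat (ext σ') i]
        congr 1
        funext l j
        unfold receive
        split_ifs with hmem
        · rfl
        · congr 1
          by_cases hl : (l : ℕ) < i
          · exact c.send_congr (fun m hm => ih m (by omega) (by omega)) j
          · have hM : 0 < M := j.pos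
            have h1 : M * i ≤ M * (l : ℕ) := Nat.mul_le_mul_left _ (by omega)
            have h2 : M * ((l : ℕ) + 1) ≤ M * (i + T + 1) := Nat.mul_le_mul_left _ (by omega)
            have h3 : M * ((l : ℕ) + 1) ≤ M * (L + T) := Nat.mul_le_mul_left _ (by omega)
            have hx : M * (l : ℕ) + j ∉ E := fun hx =>
              hmem (ha ⟨hx, by omega, by have := j.2; rw [mul_add] at h2; omega⟩)
            have hxS : M * (l : ℕ) + j ∈ S := by
              simp only [hS, Finset.mem_filter, Finset.mem_range]
              exact ⟨by have := j.2; rw [mul_add] at h3; omega, hx⟩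
            have := congrFun hσ ⟨_, hxS⟩
            simp only [Φ, hM, dif_pos, Nat.mul_add_mod, Nat.mod_eq_of_lt j.2,
              Nat.mul_add_div hM, Nat.div_eq_of_lt j.2, add_zero] at this
            exact this
    funext l
    simpa [ext] using key l l.2
  have hcard := Fintype.card_le_of_injective Φ hΦ
  simp only [Fintype.card_fun, Fintype.card_fin, Fintype.card_coe, ← pow_mul] at hcard
  exact (Nat.pow_le_pow_iff_right Fintype.one_lt_card).mp hcard

/-- The converse for the periodic erasure of the first `e` of every `M * Q` channel uses. -/
theorem IsFeasible.mul_period_le [Field F] [Finite F] {c : StreamingCode F M T n k} {N B W : ℕ}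
    (hc : c.IsFeasible N B W) {Q e : ℕ} (hM : 0 < M) (hQ : 0 < Q) (hTQ : T ≤ Q)
    (heB : e ≤ B) (he : e ≤ M * (Q - T)) : k * Q ≤ n * (M * Q - e) := by
  classical
  have hP : 0 < M * Q := Nat.mul_pos hM hQ
  have heP : e ≤ M * Q := he.trans (Nat.mul_le_mul_left _ (Nat.sub_le _ _))
  set E : Set ℕ := {x | x % (M * Q) < e} with hE
  have hwin (i : ℕ) : ∃ a, E ∩ Set.Ico (M * i) (M * (i + T + 1)) ⊆ Set.Ico a (a + B) := by
    have hi := Nat.div_add_mod i Q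
    have hr := Nat.mod_lt i hQ
    set q := i / Q
    set r := i % Q
    have hMi : M * i = M * Q * q + M * r := by rw [← hi]; ring
    have hMT : M * (i + T + 1) = M * Q * q + M * (r + T + 1) := by rw [← hi]; ring
    -- A window inside one period sees only that period's burst. Otherwise `he` ends that burst
    -- before the window starts, and only the next burst can be seen.
    by_cases hrT : r + T + 1 ≤ Q
    · refine ⟨M * Q * q, ?_⟩
      rintro x ⟨hx, hx1, hx2⟩
      have h3 : M * (r + T + 1) ≤ M * Q := Nat.mul_le_mul_left _ hrT
      obtain ⟨y, rfl⟩ : ∃ y, x = M * Q * q + y := ⟨x - M * Q * q, by omega⟩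
      simp only [hE, Set.mem_ofPred_eq, Nat.mul_add_mod] at hx
      rw [Nat.mod_eq_of_lt (by omega)] at hx
      exact ⟨by omega, by omega⟩
    · refine ⟨M * Q * (q + 1), ?_⟩
      rintro x ⟨hx, hx1, hx2⟩
      have h3 : M * (Q - T) ≤ M * r := Nat.mul_le_mul_left _ (by omega)
      have h4 : M * (r + T + 1) ≤ M * (Q + Q) := Nat.mul_le_mul_left _ (by omega)
      rw [mul_add M Q Q] at h4
      have h5 : M * Q * (q + 1) = M * Q * q + M * Q := by ring
      by_cases hx3 : x < M * Q * (q + 1)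
      · obtain ⟨y, rfl⟩ : ∃ y, x = M * Q * q + y := ⟨x - M * Q * q, by omega⟩
        simp only [hE, Set.mem_ofPred_eq, Nat.mul_add_mod] at hx
        rw [Nat.mod_eq_of_lt (by omega)] at hx
        omega
      · obtain ⟨y, rfl⟩ : ∃ y, x = M * Q * (q + 1) + y := ⟨x - M * Q * (q + 1), by omega⟩
        simp only [hE, Set.mem_ofPred_eq, Nat.mul_add_mod] at hx
        rw [Nat.mod_eq_of_lt (by omega)] at hx
        exact ⟨by omega, by omega⟩
  have hcount (m : ℕ) : Nat.count (· ∉ E) (M * Q * m) = m * (M * Q - e) := by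
    have hone (r : ℕ) (hr : r ≤ M * Q) : Nat.count (· ∉ E) r = r - e := by
      induction r with
      | zero => simp
      | succ r ih =>
        rw [Nat.count_succ, ih (by omega)]
        have : r ∈ E ↔ r < e := by simp [hE, Nat.mod_eq_of_lt (show r < M * Q by omega)]
        split_ifs <;> simp_all <;> omega
    induction m with
    | zero => simp
    | succ m ih =>
      have h6 : (fun x => M * Q * m + x ∉ E) = (· ∉ E) := by
        funext x
        simp [hE]
      rw [mul_add, mul_one, Nat.count_add, ih]
      simp only [h6]
      rw [hone _ le_rfl]
      ring
  have hmain (m : ℕ) : m * (k * Q) ≤ m * (n * (M * Q - e)) + n * (M * T) := by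
    have h := hc.mul_le_card E (m * Q) (fun i _ => hwin i)
    rw [← Nat.count_eq_card_filter_range,
      show M * (m * Q + T) = M * Q * m + M * T by ring, Nat.count_add, hcount] at h
    have h7 : Nat.count (fun x => M * Q * m + x ∉ E) (M * T) ≤ M * T := Nat.count_le _
    calc m * (k * Q) = k * (m * Q) := by ring
      _ ≤ _ := h
      _ ≤ n * (m * (M * Q - e) + M * T) := Nat.mul_le_mul_left _ (by omega)
      _ = _ := by ring
  by_contra hlt
  -- A gain of one per period over this many periods exceeds the boundary term `n * (M * T)`.
  have h8 := hmain (n * (M * T) + 1)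
  have h9 : (n * (M * T) + 1) * (n * (M * Q - e) + 1) ≤ (n * (M * T) + 1) * (k * Q) :=
    Nat.mul_le_mul_left _ (by omega)
  rw [mul_add _ _ 1] at h9
  omega

/-- The converse for a single burst at the start. -/
theorem IsFeasible.le_of_burst [Field F] [Finite F] {c : StreamingCode F M T n k} {N B W : ℕ}
    (hc : c.IsFeasible N B W) : k ≤ n * (M * (T + 1) - B) := by
  classical
  have h := hc.mul_le_card (Set.Ico 0 B) 1 (fun i _ => ⟨0, fun x hx => by simpa using hx.1⟩)
  have h2 : (Finset.range (M * (1 + T))).filter (· ∉ Set.Ico 0 B) =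
      Finset.Ico B (M * (1 + T)) := by
    ext x
    simp only [Finset.mem_filter, Finset.mem_range, Set.mem_Ico, Finset.mem_Ico]
    omega
  rwa [h2, Nat.card_Ico, mul_one, add_comm 1 T] at h

end StreamingCode

/-! ### Counting positions of a periodic layout -/

theorem Nat.count_add_card_filter_Ico (p : ℕ → Prop) [DecidablePred p] {a b : ℕ} (hab : a ≤ b) :
    Nat.count p a + ((Finset.Ico a b).filter p).card = Nat.count p b := by
  rw [Nat.count_eq_card_filter_range, Nat.count_eq_card_filter_range, Finset.range_eq_Ico,
    Finset.range_eq_Ico, ← Finset.card_union_of_disjoint, ← Finset.filter_union,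
    Finset.Ico_union_Ico_eq_Ico (Nat.zero_le _) hab]
  exact Finset.disjoint_filter_filter (Finset.Ico_disjoint_Ico_consecutive _ _ _)

/-- Position `x` lies in the slots `lo, …, hi - 1` of its frame of length `N`. -/
abbrev InSlots (N lo hi x : ℕ) : Prop := lo ≤ x % N ∧ x % N < hi

theorem count_inSlots_of_le {N lo hi r : ℕ} (hr : r ≤ N) :
    Nat.count (InSlots N lo hi) r = min r hi - min r lo := by
  induction r with
  | zero => simp
  | succ r ih =>
    have : InSlots N lo hi r ↔ lo ≤ r ∧ r < hi := by
      simp [InSlots, Nat.mod_eq_of_lt (show r < N by omega)]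
    rw [Nat.count_succ, ih (by omega)]
    simp only [this]
    split_ifs <;> omega

theorem count_inSlots {N lo hi : ℕ} (hlo : lo ≤ hi) (hhi : hi ≤ N) (m : ℕ) {r : ℕ} (hr : r ≤ N) :
    Nat.count (InSlots N lo hi) (m * N + r) = m * (hi - lo) + (min r hi - min r lo) := by
  induction m with
  | zero => simp [count_inSlots_of_le hr]
  | succ m ih =>
    rw [show (m + 1) * N + r = N + (m * N + r) by ring, Nat.count_add,
      count_inSlots_of_le le_rfl]
    simp only [InSlots, Nat.add_mod_left] at ih ⊢
    rw [ih, min_eq_right hhi, min_eq_right (hlo.trans hhi), add_mul]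
    omega

theorem count_add_count_le {p q : ℕ → Prop} [DecidablePred p] [DecidablePred q]
    (hpq : ∀ x, p x → ¬ q x) (L a : ℕ) :
    Nat.count p (L + a) + Nat.count q (L + a) ≤ Nat.count p L + Nat.count q L + a := by
  induction a with
  | zero => simp
  | succ a ih =>
    rw [← add_assoc, Nat.count_succ, Nat.count_succ]
    have := hpq (L + a)
    split_ifs <;> first | omega | tauto

/-! ### Cauchy parities -/

open Polynomial in
/-- A Cauchy matrix with at least as many rows as columns has trivial kernel. -/
theorem eq_zero_of_cauchy {F ι : Type*} [Field F] {J P : Finset ι} {φ : ι → F}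
    (hφ : Set.InjOn φ (J ∪ P : Set ι)) (hd : Disjoint J P) (hcard : J.card ≤ P.card) (v : ι → F)
    (h : ∀ x ∈ P, ∑ y ∈ J, (φ x - φ y)⁻¹ * v y = 0) : ∀ y ∈ J, v y = 0 := by
  classical
  have hne : ∀ x ∈ P, ∀ z ∈ J, φ x - φ z ≠ 0 := fun x hx z hz h0 =>
    Finset.disjoint_left.mp hd hz
      ((hφ (Or.inr hx) (Or.inl hz) (sub_eq_zero.mp h0)) ▸ hx)
  -- At `φ x` this is a multiple of row `x` of the system, so `f` has `P.card` roots but degree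
  -- below `J.card`. At `φ y` only the term of `v y` survives.
  set f : F[X] := ∑ y ∈ J, C (v y) * ∏ z ∈ J.erase y, (X - C (φ z)) with hf
  have hf0 : f = 0 := by
    apply Polynomial.eq_zero_of_degree_lt_of_eval_finset_eq_zero (P.image φ)
    · rw [Finset.card_image_of_injOn (hφ.mono Set.subset_union_right)]
      refine lt_of_lt_of_le ?_ (Nat.cast_le.mpr hcard)
      rcases J.eq_empty_or_nonempty with rfl | ⟨y0, hy0⟩
      · simp [hf]
      refine (Polynomial.degree_sum_le _ _).trans_lt ?_
      rw [Finset.sup_lt_iff (WithBot.bot_lt_coe _)]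
      intro y hy
      rw [← Polynomial.smul_eq_C_mul]
      refine (Polynomial.degree_smul_le _ _).trans_lt ?_
      rw [Polynomial.degree_prod]
      simp only [Polynomial.degree_X_sub_C, Finset.sum_const, Finset.card_erase_of_mem hy,
        nsmul_eq_mul, mul_one]
      have := Finset.card_pos.mpr ⟨y, hy⟩
      exact_mod_cast Nat.sub_lt this one_pos
    · simp only [Finset.mem_image, forall_exists_index, and_imp, forall_apply_eq_imp_iff₂]
      intro x hx
      have : f.eval (φ x) = (∏ z ∈ J, (φ x - φ z)) * ∑ y ∈ J, (φ x - φ y)⁻¹ * v y := by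
        rw [hf, Polynomial.eval_finsetSum, Finset.mul_sum]
        refine Finset.sum_congr rfl fun y hy => ?_
        rw [← Finset.mul_prod_erase J _ hy]
        simp only [eval_mul, eval_C, eval_prod, eval_sub, eval_X]
        field_simp [hne x hx y hy]
      rw [this, h x hx, mul_zero]
  intro y hy
  have h1 : f.eval (φ y) = v y * ∏ z ∈ J.erase y, (φ y - φ z) := by
    rw [hf, Polynomial.eval_finsetSum, Finset.sum_eq_single_of_mem y hy]
    · simp [eval_prod]
    · intro w hw hwy
      rw [eval_mul, eval_prod, Finset.prod_eq_zero (Finset.mem_erase.mpr ⟨hwy.symm, hy⟩),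
        mul_zero]
      simp
  rw [hf0, eval_zero] at h1
  refine (mul_eq_zero.mp h1.symm).resolve_right (Finset.prod_ne_zero_iff.mpr fun z hz h0 => ?_)
  obtain ⟨hzy, hz⟩ := Finset.mem_erase.mp hz
  exact hzy (hφ (Or.inl hy) (Or.inl hz) (sub_eq_zero.mp h0)).symm

/-! ### The linear stream of the code

Frames of `N` positions each carry the `k` coordinates of a source symbol in slots `0, …, k - 1`
and parities in the last `u` slots. A parity is the sum of one of the first `u` coordinates of the
source symbol `T` frames earlier, and of a Cauchy combination of all earlier coordinates in the slots
`u, …, k - 1`. -/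

/-- The output at position `x`, for the source coordinates `val`. -/
def layeredOutput {F : Type} [Field F] (N T u k : ℕ) (val : ℕ → F) (x : ℕ) : F :=
  if x % N < k then val x
  else if N - u ≤ x % N then
    (if T * N + (N - u) ≤ x then val (x - (T * N + (N - u))) else 0) +
      ∑ y ∈ (Finset.range x).filter (InSlots N u k), ((x : F) - (y : F))⁻¹ * val y
  else 0

section layeredOutput

variable {F : Type} [Field F] {N T u k : ℕ}

theorem layeredOutput_congr {val val' : ℕ → F} {x : ℕ} (h : ∀ y ≤ x, val y = val' y) :
    layeredOutput N T u k val x = layeredOutput N T u k val' x := by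
  unfold layeredOutput
  rw [h x le_rfl, h (x - _) (Nat.sub_le _ _)]
  congr 3
  refine Finset.sum_congr rfl fun y hy => ?_
  rw [h y (Finset.mem_range.mp (Finset.mem_filter.mp hy).1).le]

theorem layeredOutput_sub (val val' : ℕ → F) (x : ℕ) :
    layeredOutput N T u k (fun y => val y - val' y) x =
      layeredOutput N T u k val x - layeredOutput N T u k val' x := by
  unfold layeredOutput
  simp only [mul_sub, Finset.sum_sub_distrib]
  split_ifs <;> ring

/-- Dropping leading frames of zeros shifts the output. -/
theorem layeredOutput_add {val : ℕ → F} {i : ℕ} (h : ∀ y < i * N, val y = 0) (x : ℕ) :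
    layeredOutput N T u k val (i * N + x) = layeredOutput N T u k (fun y => val (i * N + y)) x := by
  unfold layeredOutput
  have hmod (y : ℕ) : (i * N + y) % N = y % N := Nat.mul_add_mod' i N y
  have hsum : ∑ y ∈ (Finset.range (i * N + x)).filter (InSlots N u k),
      (((i * N + x : ℕ) : F) - (y : F))⁻¹ * val y =
      ∑ y ∈ (Finset.range x).filter (InSlots N u k),
        ((x : F) - (y : F))⁻¹ * val (i * N + y) := by
    rw [Finset.sum_filter, Finset.sum_range_add, Finset.sum_filter, Finset.sum_eq_zero, zero_add]
    · refine Finset.sum_congr rfl fun y _ => ?_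
      simp only [InSlots, hmod, Nat.cast_add, add_sub_add_left_eq_sub]
    · intro y hy
      rw [h y (Finset.mem_range.mp hy), mul_zero, ite_self]
  have hrep : (if T * N + (N - u) ≤ i * N + x then val (i * N + x - (T * N + (N - u))) else 0) =
      if T * N + (N - u) ≤ x then val (i * N + (x - (T * N + (N - u)))) else 0 := by
    split_ifs with h1 h2 h2
    · rw [Nat.add_sub_assoc h2]
    · exact h _ (by omega)
    · omega
    · rfl
  rw [hmod, hsum, hrep]

/-- If the first `a` positions and those from `a + L` on carry zeros, then the first source symbol
is zero. -/
theorem eq_zero_of_layeredOutput_eq_zero {L a : ℕ} {val : ℕ → F} (huk : u ≤ k) (hkN : k + u ≤ N)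
    (hL : L + k ≤ (T + 1) * N)
    (hcount : Nat.count (InSlots N u k) L + Nat.count (InSlots N (N - u) N) L ≤ T * u)
    (hinj : Set.InjOn (fun x : ℕ => (x : F)) (Set.Ico 0 ((T + 1) * N)))
    (h : ∀ x < (T + 1) * N, x ∉ Set.Ico a (a + L) → layeredOutput N T u k val x = 0)
    {x : ℕ} (hx : x < k) : val x = 0 := by
  have hN : 0 < N := by omega
  have hTN : (T + 1) * N = T * N + N := by ring
  have hlow {y : ℕ} (hy : y < k) : y % N = y := Nat.mod_eq_of_lt (by omega)
  have hval {y : ℕ} (hy : y < (T + 1) * N) (hyk : y % N < k) (hya : y ∉ Set.Ico a (a + L)) :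
      val y = 0 := by
    have := h y hy hya
    rwa [layeredOutput, if_pos hyk] at this
  have hNle : N ≤ (T + 1) * N := by rw [hTN]; omega
  by_cases hak : k ≤ a
  · exact hval (by omega) (by rwa [hlow hx]) (by simp only [Set.mem_Ico]; omega)
  push Not at hak
  set D := T * N + (N - u) with hD
  set J := (Finset.Ico a (a + L)).filter (InSlots N u k) with hJ
  -- The parity at `D + x` repeats coordinate `x` of frame 0, which precedes the burst when `x < a`;
  -- parities before `D` repeat nothing. Those in `P` are thus pure Cauchy equations.
  set P := (Finset.Ico (a + L) (D + min a u)).filter (InSlots N (N - u) N) with hP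
  have hcard : J.card ≤ P.card := by
    have h1 := Nat.count_add_card_filter_Ico (InSlots N u k) (Nat.le_add_right a L)
    have h2 := Nat.count_add_card_filter_Ico (InSlots N (N - u) N)
      (show a + L ≤ D + min a u by omega)
    rw [count_inSlots_of_le (by omega)] at h1
    rw [hD, add_assoc, count_inSlots (by omega) le_rfl T (by omega)] at h2
    rw [← hJ] at h1
    rw [← add_assoc, ← hD, ← hP, Nat.sub_sub_self (by omega)] at h2
    -- Shifting the burst by `a` raises the two counts by at most `a`. This is offset by the `a -
    -- min a u` Cauchy coordinates before the burst and the `min a u` extra parities in `P`.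
    have h3 := count_add_count_le (p := InSlots N u k) (q := InSlots N (N - u) N)
      (fun x hx hx' => by omega) L a
    rw [add_comm L a] at h3
    omega
  have hJ0 : ∀ y ∈ J, val y = 0 := by
    refine eq_zero_of_cauchy (P := P) (φ := fun x : ℕ => (x : F)) (hinj.mono ?_) ?_ hcard val ?_
    · rintro y (hy | hy)
      · simp only [hJ, Finset.coe_filter, Finset.mem_Ico, Set.mem_ofPred_eq] at hy
        simp only [Set.mem_Ico]; omega
      · simp only [hP, Finset.coe_filter, Finset.mem_Ico, Set.mem_ofPred_eq] at hy
        simp only [Set.mem_Ico]; omega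
    · exact Finset.disjoint_filter_filter (Finset.Ico_disjoint_Ico_consecutive _ _ _)
    · intro y hy
      simp only [hP, Finset.mem_filter, Finset.mem_Ico] at hy
      obtain ⟨⟨hy1, hy2⟩, hy3, hy4⟩ := hy
      have hy0 := h y (by omega) (by simp only [Set.mem_Ico]; omega)
      rw [layeredOutput, if_neg (by omega), if_pos hy3] at hy0
      have hu : (if D ≤ y then val (y - D) else 0) = 0 := by
        split_ifs with hDy
        · exact hval (by omega) (by rw [hlow (by omega)]; omega)
            (by simp only [Set.mem_Ico]; omega)
        · rfl
      rw [← hD, hu, zero_add] at hy0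
      rw [← hy0]
      refine Finset.sum_subset ?_ ?_
      · intro z hz
        simp only [hJ, Finset.mem_filter, Finset.mem_Ico, Finset.mem_range] at hz ⊢
        exact ⟨by omega, hz.2⟩
      · intro z hz hzJ
        simp only [Finset.mem_filter, Finset.mem_range] at hz
        rw [hval (by omega) hz.2.2 fun hz' => hzJ ?_, mul_zero]
        simpa only [hJ, Finset.mem_filter, Finset.mem_Ico] using ⟨hz', hz.2⟩
  have hv {y : ℕ} (hy : y < (T + 1) * N) (hyv : InSlots N u k y) : val y = 0 := by
    by_cases hya : y ∈ Set.Ico a (a + L)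
    · exact hJ0 y (by simpa only [hJ, Finset.mem_filter, Finset.mem_Ico] using ⟨hya, hyv⟩)
    · exact hval hy hyv.2 hya
  by_cases hxu : u ≤ x
  · exact hv (by omega) ⟨by rwa [hlow hx], by rwa [hlow hx]⟩
  by_cases hxa : x < a
  · exact hval (by omega) (by rwa [hlow hx]) (by simp only [Set.mem_Ico]; omega)
  -- Now `a ≤ x < u`, so the parity at `D + x` lies after the burst; its Cauchy part vanishes,
  -- leaving `val x`.
  have hmod : (D + x) % N = N - u + x := by
    rw [hD, add_assoc, mul_comm, Nat.mul_add_mod, Nat.mod_eq_of_lt (by omega)]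
  have h0 := h (D + x) (by omega) (by simp only [Set.mem_Ico]; omega)
  rw [layeredOutput, if_neg (by omega), if_pos (by omega), if_pos (by omega), ← hD,
    Nat.add_sub_cancel_left, Finset.sum_eq_zero, add_zero] at h0
  · exact h0
  · intro y hy
    simp only [Finset.mem_filter, Finset.mem_range] at hy
    rw [hv (by omega) hy.2, mul_zero]

end layeredOutput

/-! ### Achievability -/

namespace StreamingCode

/-- An encoder that separates source streams is decodable. -/
theorem exists_isFeasible_of_separating {F : Type} [Zero F] {M T n k N B W : ℕ}
    (c : StreamingCode F M T n k)
    (h : ∀ E, IsErasurePattern N B W E → ∀ (s s' : ℕ → Fin k → F) (i : ℕ),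
      (∀ l < i, s l = s' l) →
      (∀ l < i + T + 1, ∀ j, c.receive E s l j = c.receive E s' l j) → s i = s' i) :
    ∃ c' : StreamingCode F M T n k, c'.IsFeasible N B W := by
  classical
  let dec : (i : ℕ) → (Fin (i + T + 1) → Fin M → Option (Fin n → F)) → Fin k → F := fun i y =>
    if hy : ∃ E s, IsErasurePattern N B W E ∧
        y = fun (l : Fin (i + T + 1)) j => c.receive E s l j then
      hy.choose_spec.choose i else 0
  refine ⟨⟨c.enc, dec⟩, fun E hE s i => ?_⟩
  have hy : ∃ E' s', IsErasurePattern N B W E' ∧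
      (fun (l : Fin (i + T + 1)) j => c.receive E s l j) =
        fun (l : Fin (i + T + 1)) j => c.receive E' s' l j :=
    ⟨E, s, hE, rfl⟩
  change dec i (fun l j => c.receive E s l j) = s i
  simp only [dec, dif_pos hy]
  obtain ⟨-, heq⟩ := hy.choose_spec.choose_spec
  set E' := hy.choose
  set s' := hy.choose_spec.choose
  -- Erasures are visible, so `E` and `E'` agree on the window and `E'` can be replaced by `E`.
  have hrec (l : ℕ) (hl : l < i + T + 1) (j : Fin M) :
      c.receive E s l j = c.receive E s' l j := by
    have h1 : c.receive E s l j = c.receive E' s' l j := congrFun (congrFun heq ⟨l, hl⟩) j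
    unfold receive at h1 ⊢
    split_ifs at h1 ⊢ <;> simp_all
  have hall (m : ℕ) : m ≤ i → s m = s' m := by
    induction m using Nat.strong_induction_on with
    | _ m ih =>
      intro hm
      exact h E hE s s' m (fun l hl => ih l hl (by omega)) fun l hl => hrec l (by omega)
  exact (hall i le_rfl).symm

/-- The coordinates of a source stream, arranged in frames of length `N`. -/
def coordStream {F : Type} [Zero F] (N : ℕ) {k : ℕ} (s : ℕ → Fin k → F) (x : ℕ) : F :=
  if h : x % N < k then s (x / N) ⟨x % N, h⟩ else 0

/-- The streaming code whose coordinates are given by `layeredOutput`. -/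
def layered (F : Type) [Field F] (M T n k u : ℕ) : StreamingCode F M T n k where
  enc i j σ m := layeredOutput (M * n) T u k
    (coordStream (M * n) fun l => if h : l < i + 1 then σ ⟨l, h⟩ else 0) ((M * i + j) * n + m)
  dec _ _ := 0

theorem layered_send {F : Type} [Field F] {M T n k u : ℕ} (s : ℕ → Fin k → F) (i : ℕ) (j : Fin M)
    (m : Fin n) : (layered F M T n k u).send s i j m =
      layeredOutput (M * n) T u k (coordStream (M * n) s) ((M * i + j) * n + m) := by
  refine layeredOutput_congr fun y hy => ?_
  have hlt : y / (M * n) < i + 1 := by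
    rw [Nat.div_lt_iff_lt_mul (Nat.mul_pos j.pos m.pos)]
    have h1 : (M * i + j + 1) * n ≤ (M * (i + 1)) * n :=
      Nat.mul_le_mul_right _ (by rw [mul_add, mul_one]; have := j.2; omega)
    rw [add_mul _ 1, one_mul] at h1
    have := m.2
    calc y < M * (i + 1) * n := by omega
      _ = _ := by ring
  simp only [coordStream, hlt, dif_pos]

theorem exists_isFeasible_layered {F : Type} [Field F] {M T n k u B W : ℕ} (hB : 1 ≤ B)
    (hW : M * (T + 1) ≤ W) (hn : 0 < n) (huk : u ≤ k) (hkN : k + u ≤ M * n)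
    (hL : B * n + k ≤ (T + 1) * (M * n))
    (hcount : Nat.count (InSlots (M * n) u k) (B * n) +
      Nat.count (InSlots (M * n) (M * n - u) (M * n)) (B * n) ≤ T * u)
    (hinj : Set.InjOn (fun x : ℕ => (x : F)) (Set.Ico 0 ((T + 1) * (M * n)))) :
    ∃ c : StreamingCode F M T n k, c.IsFeasible 1 B W := by
  refine exists_isFeasible_of_separating (layered F M T n k u) fun E hE s s' i hprev hrec => ?_
  obtain ⟨a, l, hl, hal⟩ := hE.exists_Ico hB (M * i)
  funext r
  have hN : 0 < M * n := by have := r.2; omega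
  have hM : 0 < M := Nat.pos_of_mul_pos_right hN
  set val : ℕ → F := fun y => coordStream (M * n) s y - coordStream (M * n) s' y with hval
  have hval0 : ∀ y < i * (M * n), val y = 0 := by
    intro y hy
    simp only [hval, coordStream, hprev _ (Nat.div_lt_of_lt_mul (by rwa [mul_comm])), sub_self]
  have key := eq_zero_of_layeredOutput_eq_zero (L := B * n) (a := a * n - i * (M * n))
    (val := fun y => val (i * (M * n) + y)) huk hkN hL hcount hinj ?_ r.2
  · have hr : (i * (M * n) + (r : ℕ)) % (M * n) = r := by
      rw [Nat.mul_add_mod', Nat.mod_eq_of_lt (by omega)]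
    have hq : (i * (M * n) + (r : ℕ)) / (M * n) = i := by
      rw [mul_comm i, Nat.mul_add_div hN, Nat.div_eq_of_lt (by omega), add_zero]
    simpa [hval, coordStream, hr, hq, sub_eq_zero] using key
  intro x hx hxa
  rw [← layeredOutput_add hval0, hval, layeredOutput_sub, sub_eq_zero]
  set X := i * (M * n) + x with hX
  have hXp := Nat.div_add_mod X n
  have hXm := Nat.mod_lt X hn
  have hpM := Nat.div_add_mod (X / n) M
  have hlow : M * i ≤ X / n := by
    rw [Nat.le_div_iff_mul_le hn]
    calc M * i * n = i * (M * n) := by ring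
      _ ≤ X := by omega
  have hhigh : X / n < M * (i + T + 1) := by
    rw [Nat.div_lt_iff_lt_mul hn]
    calc X < i * (M * n) + (T + 1) * (M * n) := by omega
      _ = _ := by ring
  have hXE : X / n ∉ E := by
    intro hmem
    have hin : X / n ∈ Set.Ico a (a + l) := by
      rw [← hal]
      refine ⟨hmem, hlow, hhigh.trans_le ?_⟩
      calc M * (i + T + 1) = M * i + M * (T + 1) := by ring
        _ ≤ _ := by omega
    -- A nonempty burst starts inside the window, so `a * n - i * (M * n)` does not truncate.
    have ha : a ∈ Set.Ico a (a + l) := ⟨le_rfl, hin.1.trans_lt hin.2⟩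
    rw [← hal] at ha
    have h1 : M * i * n ≤ a * n := Nat.mul_le_mul_right _ ha.2.1
    have h2 : a * n ≤ X / n * n := Nat.mul_le_mul_right _ hin.1
    have h3 : (X / n + 1) * n ≤ (a + B) * n :=
      Nat.mul_le_mul_right _ (by have := hin.2; omega)
    rw [add_mul, add_mul, one_mul, mul_comm (X / n)] at h3
    rw [mul_comm (X / n)] at h2
    rw [show M * i * n = i * (M * n) by ring] at h1
    exact hxa ⟨by omega, by omega⟩
  have hsend := hrec (X / n / M) ((Nat.div_lt_iff_lt_mul hM).mpr (by rwa [mul_comm]))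
    ⟨X / n % M, Nat.mod_lt _ hM⟩
  simp only [receive, hpM, hXE, if_false, Option.some.injEq] at hsend
  have := congrFun hsend ⟨X % n, hXm⟩
  simp only [layered_send, hpM] at this
  rwa [mul_comm (X / n) n, hXp] at this

end StreamingCode

theorem isAchievableRate_layered {M T n k u B W : ℕ} (hB : 1 ≤ B)
    (hW : M * (T + 1) ≤ W) (hn : 0 < n) (huk : u ≤ k) (hkN : k + u ≤ M * n)
    (hL : B * n + k ≤ (T + 1) * (M * n))
    (hcount : Nat.count (InSlots (M * n) u k) (B * n) +
      Nat.count (InSlots (M * n) (M * n - u) (M * n)) (B * n) ≤ T * u) :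
    IsAchievableRate M T 1 B W ((k : ℝ) / ((M : ℝ) * (n : ℝ))) := by
  -- Only positions within one window of `T + 1` frames need distinct residues, since earlier frames
  -- cancel.
  obtain ⟨p, hp, hprime⟩ := Nat.exists_infinite_primes ((T + 1) * (M * n))
  have := Fact.mk hprime
  obtain ⟨c, hc⟩ := StreamingCode.exists_isFeasible_layered (F := ZMod p) hB hW hn huk hkN hL
    hcount fun x hx y hy hxy => by
      have h := (ZMod.natCast_eq_natCast_iff' x y p).mp hxy
      rwa [Nat.mod_eq_of_lt (hx.2.trans_le hp), Nat.mod_eq_of_lt (hy.2.trans_le hp)] at h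
  exact ⟨ZMod p, inferInstance, inferInstance, n, k, c, hn, hc, rfl⟩

theorem isAchievableRate_zero (M T N B W : ℕ) : IsAchievableRate M T N B W 0 :=
  have : Fact (Nat.Prime 2) := ⟨Nat.prime_two⟩
  ⟨ZMod 2, inferInstance, inferInstance, 1, 0, ⟨fun _ _ _ => 0, fun _ _ => 0⟩, one_pos,
    fun _ _ _ _ => Subsingleton.elim _ _, by simp⟩

/-- A capacity is certified by an achievable rate and a bound on all feasible codes. -/
theorem isStreamingCapacity_of_mul_le {M T N B W k₀ d : ℕ} {C : ℝ} (hM : 0 < M) (hd : 0 < d)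
    (hC : C = (k₀ : ℝ) / ((M : ℝ) * d)) (hach : IsAchievableRate M T N B W C)
    (hle : ∀ (F : Type) [Field F] [Finite F] (n k : ℕ) (c : StreamingCode F M T n k),
      c.IsFeasible N B W → k * d ≤ n * k₀) :
    IsStreamingCapacity M T N B W C := by
  refine ⟨hach, ?_⟩
  rintro R ⟨F, _, _, n, k, c, hn, hc, rfl⟩
  have h : (k : ℝ) * d ≤ n * k₀ := by exact_mod_cast hle F n k c hc
  rw [hC, div_le_div_iff₀ (by positivity) (by positivity)]
  calc (k : ℝ) * (M * d) = M * (k * d) := by ring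
    _ ≤ M * (n * k₀) := by gcongr
    _ = _ := by ring

theorem theorem3 (M T B W b B' : ℕ) (hB : 1 ≤ B) (hW : M * (T + 1) ≤ W)
    (hsplit : B = b * M + B') (hB' : B' < M) :
    (0 < T + b → (B' : ℝ) ≤ (b : ℝ) / ((T : ℝ) + b) * M → b ≤ T →
      IsStreamingCapacity M T 1 B W ((T : ℝ) / ((T : ℝ) + b))) ∧
    ((b : ℝ) / ((T : ℝ) + b) * M < (B' : ℝ) → b < T →
      IsStreamingCapacity M T 1 B W
        (((M : ℝ) * ((T : ℝ) + b + 1) - B) / ((M : ℝ) * ((T : ℝ) + b + 1)))) ∧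
    ((M : ℝ) / 2 < (B' : ℝ) → T = b →
      IsStreamingCapacity M T 1 B W (((M : ℝ) - B') / M)) ∧
    (T < b → IsStreamingCapacity M T 1 B W 0) := by
  have hM : 0 < M := by omega
  have hM' : (0 : ℝ) < M := by exact_mod_cast hM
  refine ⟨fun hTb h hbT => ?_, fun h hbT => ?_, fun h hbT => ?_, fun hbT => ?_⟩
  · have hTb' : (0 : ℝ) < (T : ℝ) + b := by exact_mod_cast hTb
    rw [div_mul_eq_mul_div, le_div_iff₀ hTb'] at h
    have h' : B' * (T + b) ≤ b * M := by exact_mod_cast h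
    have hC : (T : ℝ) / ((T : ℝ) + b) = ((M * T : ℕ) : ℝ) / ((M : ℝ) * ((T + b : ℕ) : ℝ)) := by
      push_cast
      field_simp
    refine isStreamingCapacity_of_mul_le hM hTb hC ?_ ?_
    · rw [hC]
      obtain ⟨c, rfl⟩ := Nat.exists_eq_add_of_le hbT
      have hBn : B * (b + c + b) = b * (M * (b + c + b)) + B' * (b + c + b) := by
        rw [hsplit]; ring
      have e1 : M * (b + c + b) = M * b + M * c + M * b := by ring
      have e2 : M * (b + c) = M * b + M * c := by ring
      have e3 : b * M = M * b := mul_comm _ _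
      -- Here `n = T + b` and `k = M * T`. The burst covers `b` frames and `B' * n ≤ u` further
      -- positions, none of them counted.
      refine isAchievableRate_layered (u := M * b) hB hW hTb (by omega) (by omega) ?_ ?_
      · have e4 : (b + c + 1) * (M * (b + c + b)) =
          b * (M * (b + c + b)) + c * (M * (b + c + b)) + M * (b + c + b) := by ring
        omega
      · rw [hBn, count_inSlots (by omega) (by omega) b (by omega),
          count_inSlots (by omega) le_rfl b (by omega),
          show M * (b + c) - M * b = M * c by omega,
          show M * (b + c + b) - (M * (b + c + b) - M * b) = M * b by omega,
          show (b + c) * (M * b) = b * (M * c) + b * (M * b) by ring]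
        omega
    · intro F _ _ n k c hc
      have := hc.mul_period_le (Q := T + b) (e := M * b) hM hTb (by omega)
        (by rw [hsplit, mul_comm]; omega) (by rw [Nat.add_sub_cancel_left])
      rwa [← Nat.mul_sub, Nat.add_sub_cancel] at this
  · have hTb : 0 < T + b := by omega
    have hTb' : (0 : ℝ) < (T : ℝ) + b := by exact_mod_cast hTb
    rw [div_mul_eq_mul_div, div_lt_iff₀ hTb'] at h
    have h' : b * M < B' * (T + b) := by exact_mod_cast h
    obtain ⟨c, rfl⟩ : ∃ c, T = b + c + 1 := ⟨T - b - 1, by omega⟩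
    set n := b + c + 1 + b + 1 with hn
    have e1 : M * n = M * b + M * b + M * c + M + M := by rw [hn]; ring
    have e3 : b * M = M * b := mul_comm _ _
    have hBN : B ≤ M * n := by omega
    have hC : ((M : ℝ) * (((b + c + 1 : ℕ) : ℝ) + b + 1) - B) /
        ((M : ℝ) * (((b + c + 1 : ℕ) : ℝ) + b + 1)) =
        ((M * n - B : ℕ) : ℝ) / ((M : ℝ) * (n : ℝ)) := by
      rw [Nat.cast_sub hBN, hn]
      push_cast
      rfl
    refine isStreamingCapacity_of_mul_le hM (Nat.succ_pos _) hC ?_ ?_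
    · rw [hC]
      have hBn : B * n = b * (M * n) + B' * n := by rw [hsplit]; ring
      have hBn2 : B * n = B * (b + c + 1) + b * B + B := by rw [hn]; ring
      have hL' : B' * n ≤ M * n := Nat.mul_le_mul_right _ hB'.le
      have hBu : B ≤ B' * n := by
        have : B' * n = B' * (b + c + 1 + b) + B' := by rw [hn]; ring
        omega
      -- Here the remainder `B' * n` is at least `u`, so the partial frame contributes `B' * n - B`
      -- to the count.
      refine isAchievableRate_layered (u := B) hB hW (Nat.succ_pos _) (by omega) (by omega) ?_ ?_
      · have e4 : (b + c + 1 + 1) * (M * n) =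
          b * (M * n) + c * (M * n) + M * n + M * n := by ring
        omega
      · have hb : b * (M * n - B - B) + b * B + b * B = b * (M * n) := by
          rw [← mul_add, ← mul_add]
          congr 1
          omega
        rw [hBn, count_inSlots (by omega) (by omega) b hL',
          count_inSlots (by omega) le_rfl b hL', Nat.sub_sub_self hBN,
          mul_comm (b + c + 1) B]
        omega
    · intro F _ _ n' k c' hc
      refine hc.mul_period_le (Q := n) (e := B) hM (Nat.succ_pos _) (by omega) le_rfl ?_
      rw [show n - (b + c + 1) = b + 1 by omega, mul_add, mul_one]
      omega
  · subst hbT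
    have h' : M < 2 * B' := by
      rw [div_lt_iff₀ two_pos] at h
      have : M < B' * 2 := by exact_mod_cast h
      omega
    have hC : ((M : ℝ) - B') / M = ((M - B' : ℕ) : ℝ) / ((M : ℝ) * ((1 : ℕ) : ℝ)) := by
      rw [Nat.cast_sub hB'.le, Nat.cast_one, mul_one]
    refine isStreamingCapacity_of_mul_le hM one_pos hC ?_ ?_
    · rw [hC]
      -- With `k = u` there are no Cauchy coordinates: the code is pure repetition.
      refine isAchievableRate_layered (u := M - B') hB hW one_pos le_rfl (by omega) ?_ ?_
      · rw [mul_one, mul_one, add_mul, one_mul]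
        omega
      · rw [mul_one, mul_one, hsplit, count_inSlots le_rfl (by omega) T hB'.le,
          count_inSlots (by omega) le_rfl T hB'.le, Nat.sub_self, mul_zero,
          Nat.sub_sub_self (by omega)]
        omega
    · intro F _ _ n k c hc
      have := hc.le_of_burst
      rwa [hsplit, show M * (T + 1) - (T * M + B') = M - B' by
        rw [mul_add, mul_comm]; omega, ← mul_one k] at this
  · refine isStreamingCapacity_of_mul_le (k₀ := 0) hM one_pos (by simp)
      (isAchievableRate_zero ..) ?_
    intro F _ _ n k c hc
    have h1 := hc.le_of_burst
    have h2 : M * (T + 1) ≤ b * M := by rw [mul_comm b]; exact Nat.mul_le_mul_left _ hbT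
    rwa [Nat.sub_eq_zero_of_le (by omega), ← mul_one k] at h1
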